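/- Let $(X,\rho)$ be a compact metric space and let $T\colon X\to X$ be a continuous map (for instance a homeomorphism). Let $\mathcal M_T(X)$ be the set of $T$-invariant Borel probability measures on $X$. For $\mu,\nu\in\mathcal M_T(X)$ put $$\bar\rho(\mu,\nu)=\inf_{\lambda}\int_{X\times X}\rho(x,y)\,d\lambda(x,y),$$ where $\lambda$ ranges over all joinings of $\mu$ and $\nu$, i.e. all $T\times T$-invariant Borel measures on $X\times X$ whose first and second marginals are $\mu$ and $\nu$. For a strictly increasing sequence $(n_k)$ of positive integers and $x,x'\in X$ put $$D_B^{(n_k)}(x,x')=\limsup_{k\to\infty}\frac1{n_k}\sum_{j=0}^{n_k-1}\rho(T^jx,T^jx'),\qquad D_B(x,x')=\limsup_{N\to\infty}\frac1N\sum_{j=0}^{N-1}\rho(T^jx,T^jx').$$ A point $x\in X$ is quasi-generic for $\mu$ along $(n_k)$ if $\frac1{n_k}\sum_{j=0}^{n_k-1}f(T^jx)\to\int f\,d\mu$ as $k\to\infty$ for every continuous $f\colon X\to\mathbb C$; the set $\mathrm{Gen}(\mu)$ of generic points for $\mu$ consists of the points that are quasi-generic for $\mu$ along every strictly increasing sequence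 of positive integers. Let $(\mu_m)_{m\ge1}$ be a sequence of ergodic measures in $\mathcal M_T(X)$. The following conditions are equivalent: 1. There is $\mu\in\mathcal M_T(X)$ such that $\bar\rho(\mu_m,\mu)\to0$ as $m\to\infty$. 2. There are points $x_m\in\mathrm{Gen}(\mu_m)$ $(m\ge1)$ and $x\in X$ such that $D_B(x,x_m)\to0$ as $m\to\infty$. 3. There are a strictly increasing sequence $(n_k)$ of positive integers, points $y_m\in X$ $(m\ge1)$ such that $y_m$ is quasi-generic for $\mu_m$ along $(n_k)$ for every $m$, and a point $y\in X$ such that $D_B^{(n_k)}(y,y_m)\to0$ as $m\to\infty$. Moreover, suppose that $\mu\in\mathcal M_T(X)$ satisfies $\bar\rho(\mu_m,\mu)\to0$. Then $\mu$ is ergodic; whenever $x$ and $(x_m)$ are as in (2), $x\in\mathrm{Gen}(\mu)$; and whenever $(n_k)$, $y$ and $(y_m)$ are as in (3), $y$ is quasi-generic for $\mu$ along $(n_k)$. In addition, the points in (2) can be chosen so that $x\in\mathrm{Gen}(\mu)$ and, for every $m\ge1$, $$D_B(x,x_m)=\lim_{n\to\infty}\frac1n\sum_{j=0}^{n-1}\rho(T^jx,T^jx_m)=\bar\rho(\mu_m,\mu).$$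 -/

import Mathlib

open Filter Topology MeasureTheory

noncomputable section

namespace RhoBar

variable {X : Type*}

/-- The average `(1/n) * ∑_{j<n} ρ(T^j x, T^j y)` of the distance along two orbits. -/
def orbitAvgDist [MetricSpace X] (T : X → X) (n : ℕ) (x y : X) : ℝ :=
  (1 / (n : ℝ)) * ∑ j ∈ Finset.range n, dist (T^[j] x) (T^[j] y)

/-- The Besicovitch pseudometric `D_B`. On a compact (hence bounded) space the averages are
bounded, so the real-valued `limsup` is the usual upper limit. -/
def besicovitchDist [MetricSpace X] (T : X → X) (x y : X) : ℝ :=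
  limsup (fun N : ℕ => orbitAvgDist T N x y) atTop

/-- The Besicovitch pseudometric `D_B^{(n_k)}` along a sequence `(n_k)`. -/
def besicovitchDistAlong [MetricSpace X] (T : X → X) (n : ℕ → ℕ) (x y : X) : ℝ :=
  limsup (fun k : ℕ => orbitAvgDist T (n k) x y) atTop

/-- `x` is quasi-generic for `μ` along `(n_k)`: the averages of every continuous
`f : X → ℂ` along the orbit of `x`, taken over times `n_k`, converge to `∫ f dμ`. -/
def IsQuasiGeneric [TopologicalSpace X] [MeasurableSpace X] (T : X → X) (μ : Measure X)
    (n : ℕ → ℕ) (x : X) : Prop :=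
  ∀ f : C(X, ℂ), Tendsto
    (fun k : ℕ => (1 / (n k : ℂ)) * ∑ j ∈ Finset.range (n k), f (T^[j] x))
    atTop (𝓝 (∫ z, f z ∂μ))

/-- `Gen(μ)`: the points that are quasi-generic for `μ` along every strictly increasing
sequence of positive integers. -/
def genericPoints [TopologicalSpace X] [MeasurableSpace X] (T : X → X) (μ : Measure X) :
    Set X :=
  {x | ∀ n : ℕ → ℕ, StrictMono n → (∀ k, 0 < n k) → IsQuasiGeneric T μ n x}

/-- `J(μ, ν)`: the joinings of `μ` and `ν`, that is, the `T × T`-invariant measures on `X × X`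
with marginals `μ` and `ν`. -/
def joinings [MeasurableSpace X] (T : X → X) (μ ν : Measure X) : Set (Measure (X × X)) :=
  {l | MeasurePreserving (Prod.map T T) l l ∧ l.map Prod.fst = μ ∧ l.map Prod.snd = ν}

/-- `ρ̄(μ, ν)`: the infimum of `∫ ρ dλ` over all joinings `λ` of `μ` and `ν`. For invariant
probability measures the product measure is a joining, so the infimum is over a nonempty set
of nonnegative reals. -/
def rhoBar [MetricSpace X] [MeasurableSpace X] (T : X → X) (μ ν : Measure X) : ℝ :=
  sInf ((fun l : Measure (X × X) => ∫ p, dist p.1 p.2 ∂l) '' joinings T μ ν)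

end RhoBar

end

/-! The averaged distance along two orbits is the integral of ρ against the empirical measure of the
pair under `T × T`. If both points are quasi-generic, every limit of these empirical measures is a
joining. Compactness of the space of probability measures thus links orbit averages to `rhoBar` in
both directions.

From 3 to 1, take the limit `ν` of the empirical measures of `y` along an ultrafilter. Along the
same ultrafilter the pairs formed with `y_m` converge to joinings of `μ_m` and `ν`, whose cost is at
most `D_B^{(n_k)}(y, y_m)`.

From 1 to 2, `ν` is first shown to be ergodic: mean convergence of Birkhoff averages passes from
`μ_m` to `ν` through a joining, with an error independent of the length of the averages. Let λ be an
optimal joining of `μ_m` and `ν`. Almost every pair for λ has generic coordinates, so its averaged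
distances have lower limit at least `rhoBar`, which is also the λ-mean of ρ. Averages whose lower
limits are at least the mean converge to it almost everywhere, so λ need not be ergodic. Hence
`ν`-almost every `x` has a generic partner for `μ_m` at averaged distance exactly `rhoBar`. As there
are countably many `m`, one `x` serves them all.

Genericity of the limit points holds because small averaged distance forces close averages of every
continuous function. -/

namespace RhoBar

/-! ### Maximal inequality and pointwise ergodic theorem for bounded functions -/

section Birkhoff

variable {Y : Type*}

/-- The maximum of `0` and the Birkhoff sums of `h` of length at most `N`. -/
noncomputable def maxBirkhoffSum (S : Y → Y) (h : Y → ℝ) : ℕ → Y → ℝ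
  | 0, _ => 0
  | N + 1, x => max 0 (h x + maxBirkhoffSum S h N (S x))

theorem maxBirkhoffSum_nonneg (S : Y → Y) (h : Y → ℝ) (N : ℕ) (x : Y) :
    0 ≤ maxBirkhoffSum S h N x := by
  cases N with
  | zero => exact le_rfl
  | succ N => exact le_max_left _ _

theorem maxBirkhoffSum_le_succ (S : Y → Y) (h : Y → ℝ) (N : ℕ) (x : Y) :
    maxBirkhoffSum S h N x ≤ maxBirkhoffSum S h (N + 1) x := by
  induction N generalizing x with
  | zero => exact maxBirkhoffSum_nonneg S h 1 x
  | succ N ih =>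
    have := ih (S x)
    simp only [maxBirkhoffSum] at this ⊢
    gcongr

theorem monotone_maxBirkhoffSum (S : Y → Y) (h : Y → ℝ) (x : Y) :
    Monotone fun N => maxBirkhoffSum S h N x :=
  monotone_nat_of_le_succ fun N => maxBirkhoffSum_le_succ S h N x

theorem birkhoffSum_le_maxBirkhoffSum (S : Y → Y) (h : Y → ℝ) (N : ℕ) (x : Y) :
    birkhoffSum S h N x ≤ maxBirkhoffSum S h N x := by
  induction N generalizing x with
  | zero => simp [maxBirkhoffSum]
  | succ N ih =>
    rw [birkhoffSum_succ']
    exact le_trans (by gcongr; exact ih (S x)) (le_max_right _ _)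

/-- Garsia's inequality. Where the maximum is positive it is attained by a nonempty sum, so it
equals `h x` plus a shorter maximum at `S x`; elsewhere it vanishes and the left side is at most
`0`. -/
theorem maxBirkhoffSum_sub_comp_le_indicator (S : Y → Y) (h : Y → ℝ) (N : ℕ) (x : Y) :
    maxBirkhoffSum S h N x - maxBirkhoffSum S h N (S x) ≤
      {y | 0 < maxBirkhoffSum S h N y}.indicator h x := by
  by_cases hx : 0 < maxBirkhoffSum S h N x
  · rw [Set.indicator_of_mem (by exact hx)]
    cases N with
    | zero => exact absurd hx (lt_irrefl _)
    | succ N =>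
      have h1 : maxBirkhoffSum S h (N + 1) x = h x + maxBirkhoffSum S h N (S x) := by
        simp only [maxBirkhoffSum] at hx ⊢
        rcases lt_max_iff.1 hx with h0 | h0
        · exact absurd h0 (lt_irrefl _)
        · exact max_eq_right h0.le
      linarith [maxBirkhoffSum_le_succ S h N (S x)]
  · rw [Set.indicator_of_notMem (by exact hx)]
    linarith [maxBirkhoffSum_nonneg S h N (S x)]

theorem abs_birkhoffAverage_le (S : Y → Y) {f : Y → ℝ} {M : ℝ} (hM : ∀ x, |f x| ≤ M)
    (n : ℕ) (x : Y) : |birkhoffAverage ℝ S f n x| ≤ M := by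
  have hM0 : 0 ≤ M := (abs_nonneg _).trans (hM x)
  rcases Nat.eq_zero_or_pos n with rfl | hn
  · simpa using hM0
  have hn' : (0 : ℝ) < n := by exact_mod_cast hn
  rw [birkhoffAverage, smul_eq_mul, abs_mul, abs_of_pos (inv_pos.2 hn'), inv_mul_le_iff₀ hn']
  refine (Finset.abs_sum_le_sum_abs _ _).trans ((Finset.sum_le_card_nsmul _ _ M
    fun j _ => hM _).trans ?_)
  simp

theorem isBoundedUnder_le_birkhoffAverage (S : Y → Y) {f : Y → ℝ} {M : ℝ}
    (hM : ∀ x, |f x| ≤ M) (x : Y) (F : Filter ℕ) :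
    F.IsBoundedUnder (· ≤ ·) fun n => birkhoffAverage ℝ S f n x :=
  isBoundedUnder_of ⟨M, fun n => (abs_le.1 (abs_birkhoffAverage_le S hM n x)).2⟩

theorem isCoboundedUnder_le_birkhoffAverage (S : Y → Y) {f : Y → ℝ} {M : ℝ}
    (hM : ∀ x, |f x| ≤ M) (x : Y) (F : Filter ℕ) [F.NeBot] :
    F.IsCoboundedUnder (· ≤ ·) fun n => birkhoffAverage ℝ S f n x :=
  (isBoundedUnder_of ⟨-M, fun n =>
    (abs_le.1 (abs_birkhoffAverage_le S hM n x)).1⟩ :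
      F.IsBoundedUnder (· ≥ ·) fun n => birkhoffAverage ℝ S f n x).isCoboundedUnder_le

/-- The upper limit of the Birkhoff averages. -/
noncomputable def limsupAvg (S : Y → Y) (f : Y → ℝ) (x : Y) : ℝ :=
  limsup (fun n => birkhoffAverage ℝ S f n x) atTop

theorem abs_limsupAvg_le (S : Y → Y) {f : Y → ℝ} {M : ℝ} (hM : ∀ x, |f x| ≤ M) (x : Y) :
    |limsupAvg S f x| ≤ M := by
  have hb := isBoundedUnder_le_birkhoffAverage S hM x atTop
  have hc := isCoboundedUnder_le_birkhoffAverage S hM x atTop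
  have h := fun n => abs_le.1 (abs_birkhoffAverage_le S hM n x)
  exact abs_le.2 ⟨le_limsup_of_frequently_le (Frequently.of_forall fun n => (h n).1) hb,
    limsup_le_of_le hc (.of_forall fun n => (h n).2)⟩

theorem limsupAvg_comp (S : Y → Y) {f : Y → ℝ} {M : ℝ} (hM : ∀ x, |f x| ≤ M) (x : Y) :
    limsupAvg S f (S x) = limsupAvg S f x := by
  have h0 : Tendsto (fun n => birkhoffAverage ℝ S f n (S x) - birkhoffAverage ℝ S f n x)
      atTop (𝓝 0) := by
    refine tendsto_birkhoffAverage_apply_sub_birkhoffAverage' ℝ ?_ S x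
    exact (Metric.isBounded_closedBall (x := (0 : ℝ)) (r := M)).subset
      (Set.range_subset_iff.2 fun y => by simpa using hM y)
  refine le_antisymm ?_ ?_
  · refine le_of_forall_pos_le_add fun ε hε => ?_
    refine limsup_le_of_le (isCoboundedUnder_le_birkhoffAverage S hM _ _) ?_
    filter_upwards [eventually_lt_of_limsup_lt
      (lt_add_of_pos_right (limsupAvg S f x) (half_pos hε))
      (isBoundedUnder_le_birkhoffAverage S hM _ _), h0.eventually_lt_const (half_pos hε)]
      with n h1 h2
    linarith
  · refine le_of_forall_pos_le_add fun ε hε => ?_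
    refine limsup_le_of_le (isCoboundedUnder_le_birkhoffAverage S hM _ _) ?_
    filter_upwards [eventually_lt_of_limsup_lt
      (lt_add_of_pos_right (limsupAvg S f (S x)) (half_pos hε))
      (isBoundedUnder_le_birkhoffAverage S hM _ _),
      h0.eventually_const_lt (neg_lt_zero.2 (half_pos hε))] with n h1 h2
    linarith

theorem limsupAvg_iterate (S : Y → Y) {f : Y → ℝ} {M : ℝ} (hM : ∀ x, |f x| ≤ M) (j : ℕ) (x : Y) :
    limsupAvg S f (S^[j] x) = limsupAvg S f x := by
  induction j with
  | zero => rfl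
  | succ j ih => rw [Function.iterate_succ_apply', limsupAvg_comp S hM, ih]

variable [MeasurableSpace Y]

theorem measurable_maxBirkhoffSum {S : Y → Y} {h : Y → ℝ} (hS : Measurable S)
    (hh : Measurable h) (N : ℕ) : Measurable (maxBirkhoffSum S h N) := by
  induction N with
  | zero => exact measurable_const
  | succ N ih => exact measurable_const.max (hh.add (ih.comp hS))

theorem integrable_maxBirkhoffSum {S : Y → Y} {h : Y → ℝ} {l : Measure Y}
    (hS : MeasurePreserving S l l) (hh : Integrable h l) (N : ℕ) :
    Integrable (maxBirkhoffSum S h N) l := by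
  induction N with
  | zero => exact integrable_zero _ _ _
  | succ N ih =>
    exact (integrable_zero Y ℝ l).sup (hh.add (hS.integrable_comp_of_integrable ih))

/-- A form of the maximal ergodic theorem. -/
theorem integral_nonneg_of_forall_exists_birkhoffSum_pos {S : Y → Y} {h : Y → ℝ}
    {l : Measure Y} (hS : MeasurePreserving S l l) (hm : Measurable h) (hh : Integrable h l)
    (hpos : ∀ x, ∃ n, 0 < birkhoffSum S h n x) : 0 ≤ ∫ x, h x ∂l := by
  have hE : ∀ N, MeasurableSet {y | 0 < maxBirkhoffSum S h N y} := fun N =>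
    measurableSet_lt measurable_const (measurable_maxBirkhoffSum hS.measurable hm N)
  have hN : ∀ N, 0 ≤ ∫ x, {y | 0 < maxBirkhoffSum S h N y}.indicator h x ∂l := by
    intro N
    have hi := integrable_maxBirkhoffSum hS hh N
    have hi' : Integrable (fun x => maxBirkhoffSum S h N (S x)) l :=
      hS.integrable_comp_of_integrable hi
    have h0 : ∫ x, (maxBirkhoffSum S h N x - maxBirkhoffSum S h N (S x)) ∂l = 0 := by
      rw [integral_sub hi hi', sub_eq_zero]
      conv_lhs => rw [← hS.map_eq]
      exact integral_map hS.measurable.aemeasurable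
        (measurable_maxBirkhoffSum hS.measurable hm N).aestronglyMeasurable
    refine h0.symm.trans_le ?_
    exact integral_mono (hi.sub hi') (g := {y | 0 < maxBirkhoffSum S h N y}.indicator h)
      (hh.indicator (hE N))
      (maxBirkhoffSum_sub_comp_le_indicator S h N)
  -- By `hpos` the sets where the maximum is positive increase to the whole space.
  refine ge_of_tendsto' (tendsto_integral_of_dominated_convergence (fun x => ‖h x‖)
    (fun N => (hh.indicator (hE N)).aestronglyMeasurable) hh.norm
    (fun N => .of_forall fun x => norm_indicator_le_norm_self h x)
    (.of_forall fun x => ?_)) hN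
  obtain ⟨n, hn⟩ := hpos x
  refine tendsto_const_nhds.congr' ?_
  filter_upwards [eventually_ge_atTop n] with N hnN
  have : x ∈ {y | 0 < maxBirkhoffSum S h N y} :=
    hn.trans_le ((birkhoffSum_le_maxBirkhoffSum S h n x).trans
      (monotone_maxBirkhoffSum S h x hnN))
  rw [Set.indicator_of_mem this]

theorem measurable_birkhoffAverage {S : Y → Y} {f : Y → ℝ} (hS : Measurable S)
    (hf : Measurable f) (n : ℕ) : Measurable (birkhoffAverage ℝ S f n) := by
  have : Measurable fun x => (n : ℝ)⁻¹ • ∑ j ∈ Finset.range n, f (S^[j] x) :=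
    .const_smul (Finset.measurable_sum (Finset.range n) (f := fun j x => f (S^[j] x))
      fun j _ => hf.comp (hS.iterate j)) (n : ℝ)⁻¹
  exact this

theorem measurable_limsupAvg {S : Y → Y} {f : Y → ℝ} (hS : Measurable S)
    (hf : Measurable f) : Measurable (limsupAvg S f) :=
  Measurable.limsup fun n => measurable_birkhoffAverage hS hf n

theorem integrable_of_abs_le {l : Measure Y} [IsFiniteMeasure l] {f : Y → ℝ} {M : ℝ}
    (hf : Measurable f) (hM : ∀ x, |f x| ≤ M) : Integrable f l :=
  Integrable.of_bound hf.aestronglyMeasurable M (.of_forall hM)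

/-- The maximal theorem is applied to `f - limsupAvg S f + ε`. The upper limit is invariant, so over
`n` steps it contributes `n` times its value, and some average of `f` exceeds it minus `ε`. -/
theorem integral_limsupAvg_le {S : Y → Y} {f : Y → ℝ} {M : ℝ} {l : Measure Y}
    [IsProbabilityMeasure l] (hS : MeasurePreserving S l l) (hf : Measurable f)
    (hM : ∀ x, |f x| ≤ M) : ∫ x, limsupAvg S f x ∂l ≤ ∫ x, f x ∂l := by
  refine le_of_forall_pos_le_add fun ε hε => ?_
  have hg := measurable_limsupAvg hS.measurable hf
  have hfi := integrable_of_abs_le (l := l) hf hM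
  have hgi := integrable_of_abs_le (l := l) hg (abs_limsupAvg_le S hM)
  have key := integral_nonneg_of_forall_exists_birkhoffSum_pos (l := l)
    (h := fun x => f x - limsupAvg S f x + ε) hS ((hf.sub hg).add_const ε)
    ((hfi.sub hgi).add (integrable_const ε)) ?_
  · have h1 : ∫ x, (f x - limsupAvg S f x + ε) ∂l =
        ∫ x, (f x - limsupAvg S f x) ∂l + ∫ _, ε ∂l :=
      integral_add (hfi.sub hgi) (integrable_const ε)
    rw [h1, integral_sub hfi hgi, integral_const, probReal_univ, one_smul] at key
    linarith
  · intro x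
    have hfr : ∃ᶠ n in atTop, limsupAvg S f x - ε < birkhoffAverage ℝ S f n x :=
      frequently_lt_of_lt_limsup (isCoboundedUnder_le_birkhoffAverage S hM x atTop)
        (sub_lt_self _ hε)
    obtain ⟨n, hn, hn0⟩ := (hfr.and_eventually (eventually_gt_atTop 0)).exists
    have hn' : (0 : ℝ) < n := by exact_mod_cast hn0
    refine ⟨n, ?_⟩
    have : birkhoffSum S (fun x => f x - limsupAvg S f x + ε) n x =
        birkhoffSum S f n x - n * limsupAvg S f x + n * ε := by
      simp [birkhoffSum, Finset.sum_add_distrib, limsupAvg_iterate S hM]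
    rw [this]
    rw [birkhoffAverage, smul_eq_mul, ← div_eq_inv_mul, lt_div_iff₀ hn'] at hn
    linarith

/-- Birkhoff averages converge almost everywhere to `c = ∫ f` if their lower limits are almost
everywhere at least `c`. -/
theorem ae_tendsto_birkhoffAverage_of_le {S : Y → Y} {f : Y → ℝ} {M c : ℝ} {l : Measure Y}
    [IsProbabilityMeasure l] (hS : MeasurePreserving S l l) (hf : Measurable f)
    (hM : ∀ x, |f x| ≤ M) (hc : ∫ x, f x ∂l = c)
    (hle : ∀ᵐ x ∂l, ∀ ε > 0, ∀ᶠ n in atTop, c - ε < birkhoffAverage ℝ S f n x) :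
    ∀ᵐ x ∂l, Tendsto (fun n => birkhoffAverage ℝ S f n x) atTop (𝓝 c) := by
  have hg := measurable_limsupAvg hS.measurable hf
  have hgi := integrable_of_abs_le (l := l) hg (abs_limsupAvg_le S hM)
  have hcg : ∀ᵐ x ∂l, 0 ≤ limsupAvg S f x - c := by
    filter_upwards [hle] with x hx
    rw [sub_nonneg]
    refine le_of_forall_pos_le_add fun ε hε => ?_
    have := le_limsup_of_frequently_le ((hx ε hε).mono fun n h => h.le).frequently
      (isBoundedUnder_le_birkhoffAverage S hM x atTop)
    rw [limsupAvg]
    linarith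
  have hi : Integrable (fun x => limsupAvg S f x - c) l := hgi.sub (integrable_const c)
  -- The upper limit is almost everywhere at least `c`, yet its integral is at most `c`; hence it
  -- equals `c` almost everywhere.
  have h0 : ∫ x, (limsupAvg S f x - c) ∂l = 0 := by
    refine le_antisymm ?_ (integral_nonneg_of_ae hcg)
    rw [integral_sub hgi (integrable_const c)]
    simpa [hc] using integral_limsupAvg_le (l := l) hS hf hM
  filter_upwards [(integral_eq_zero_iff_of_nonneg_ae hcg hi).1 h0, hle] with x hx hlx
  have hx' : limsupAvg S f x = c := sub_eq_zero.1 hx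
  refine tendsto_order.2 ⟨fun a ha => ?_, fun b hb => ?_⟩
  · filter_upwards [hlx (c - a) (sub_pos.2 ha)] with n hn
    linarith
  · exact eventually_lt_of_limsup_lt (by rw [← hx'] at hb; exact hb)
      (isBoundedUnder_le_birkhoffAverage S hM x atTop)

/-- Birkhoff's pointwise ergodic theorem for ergodic maps and bounded functions. -/
theorem ae_tendsto_birkhoffAverage_of_ergodic {S : Y → Y} {f : Y → ℝ} {M : ℝ} {l : Measure Y}
    [IsProbabilityMeasure l] (hS : Ergodic S l) (hf : Measurable f) (hM : ∀ x, |f x| ≤ M) :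
    ∀ᵐ x ∂l, Tendsto (fun n => birkhoffAverage ℝ S f n x) atTop (𝓝 (∫ x, f x ∂l)) := by
  -- The lower limit of the averages of `f` is minus the upper limit for `-f`, which ergodicity
  -- makes constant.
  have hf' : Measurable (fun x => -f x) := hf.neg
  have hM' : ∀ x, |(-f x)| ≤ M := fun x => by rw [abs_neg]; exact hM x
  obtain ⟨c, hc⟩ := hS.toPreErgodic.ae_eq_const_of_ae_eq_comp
    (measurable_limsupAvg hS.measurable hf') (funext fun x => limsupAvg_comp S hM' x)
  have hc' : c ≤ -∫ x, f x ∂l := by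
    have := integral_limsupAvg_le hS.toMeasurePreserving hf' hM'
    rw [integral_congr_ae hc, integral_neg] at this
    simpa using this
  refine ae_tendsto_birkhoffAverage_of_le hS.toMeasurePreserving hf hM rfl ?_
  filter_upwards [hc] with x hx ε hε
  have hlt : limsupAvg S (fun x => -f x) x < -(∫ x, f x ∂l) + ε := by
    rw [hx]; simp only [Function.const_apply]; linarith
  filter_upwards [eventually_lt_of_limsup_lt hlt
    (isBoundedUnder_le_birkhoffAverage S hM' x atTop)] with n hn
  have : birkhoffAverage ℝ S (fun x => -f x) n x = -birkhoffAverage ℝ S f n x := by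
    simp [birkhoffAverage, birkhoffSum]
  linarith

end Birkhoff

end RhoBar

namespace RhoBar

/-! ### Limits of empirical measures -/

section Empirical

variable {Y : Type*} [MetricSpace Y] [CompactSpace Y]

theorem exists_forall_abs_le (f : C(Y, ℝ)) : ∃ M, ∀ x, |f x| ≤ M :=
  ⟨‖f‖, fun x => f.norm_coe_le_norm x⟩

variable [MeasurableSpace Y] [BorelSpace Y]

theorem exists_integral_eq_birkhoffAverage (S : Y → Y) (z : Y) (n : ℕ) :
    ∃ p : ProbabilityMeasure Y, 0 < n →
      ∀ f : C(Y, ℝ), ∫ y, f y ∂(p : Measure Y) = birkhoffAverage ℝ S f n z := by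
  rcases Nat.eq_zero_or_pos n with rfl | hn
  · exact ⟨⟨Measure.dirac z, inferInstance⟩, fun h => absurd h (lt_irrefl 0)⟩
  refine ⟨⟨(n : ENNReal)⁻¹ • ∑ j ∈ Finset.range n, Measure.dirac (S^[j] z), ⟨?_⟩⟩, fun _ f => ?_⟩
  · simp only [Measure.smul_apply, Measure.coe_finsetSum, Finset.sum_apply, measure_univ,
      Finset.sum_const, Finset.card_range, smul_eq_mul, nsmul_eq_mul, mul_one]
    exact ENNReal.inv_mul_cancel (by exact_mod_cast hn.ne') (ENNReal.natCast_ne_top n)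
  · rw [ProbabilityMeasure.coe_mk, integral_smul_measure, integral_finsetSum_measure]
    · simp [birkhoffAverage, birkhoffSum]
    · intro j _
      exact integrable_dirac (by simp)

/-- The empirical measures along an orbit converge along an ultrafilter, to an invariant
measure. -/
theorem exists_tendsto_birkhoffAverage {S : Y → Y} (hS : Continuous S) (U : Ultrafilter ℕ)
    {n : ℕ → ℕ} (hn : Tendsto n U atTop) (z : Y) :
    ∃ l : ProbabilityMeasure Y, MeasurePreserving S (l : Measure Y) (l : Measure Y) ∧
      ∀ f : C(Y, ℝ), Tendsto (fun k => birkhoffAverage ℝ S f (n k) z) U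
        (𝓝 (∫ y, f y ∂(l : Measure Y))) := by
  choose p hp using exists_integral_eq_birkhoffAverage S z
  obtain ⟨l, -, hl⟩ := isCompact_univ.ultrafilter_le_nhds (U.map fun k => p (n k)) (by simp)
  have hlim : ∀ f : C(Y, ℝ), Tendsto (fun k => birkhoffAverage ℝ S f (n k) z) U
      (𝓝 (∫ y, f y ∂(l : Measure Y))) := by
    intro f
    have h1 : Tendsto (fun k => ∫ y, f y ∂(p (n k) : Measure Y)) U
        (𝓝 (∫ y, f y ∂(l : Measure Y))) :=
      ((ProbabilityMeasure.continuous_integral_continuousMap f).tendsto l).comp hl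
    refine h1.congr' ?_
    filter_upwards [hn.eventually (eventually_gt_atTop 0)] with k hk using hp _ hk f
  refine ⟨l, ⟨hS.measurable, ?_⟩, hlim⟩
  have : IsProbabilityMeasure ((l : Measure Y).map S) :=
    Measure.isProbabilityMeasure_map hS.measurable.aemeasurable
  refine ext_of_forall_integral_eq_of_IsFiniteMeasure fun f => ?_
  rw [integral_map hS.measurable.aemeasurable f.continuous.aestronglyMeasurable]
  obtain ⟨M, hM⟩ := exists_forall_abs_le f.toContinuousMap
  have h0 : Tendsto (fun n => birkhoffAverage ℝ S f n (S z) - birkhoffAverage ℝ S f n z)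
      atTop (𝓝 0) := by
    refine tendsto_birkhoffAverage_apply_sub_birkhoffAverage' ℝ ?_ S z
    exact (Metric.isBounded_closedBall (x := (0 : ℝ)) (r := M)).subset
      (Set.range_subset_iff.2 fun y => by simpa using hM y)
  have h1 := (h0.comp hn).add (hlim f.toContinuousMap)
  rw [zero_add] at h1
  -- Averaging `f ∘ S` from `z` is averaging `f` from `S z`, which asymptotically agrees with
  -- averaging from `z`.
  refine tendsto_nhds_unique (hlim ⟨fun y => f (S y), f.continuous.comp hS⟩) (h1.congr fun k => ?_)
  simp [birkhoffAverage, birkhoffSum, ← Function.iterate_succ_apply', Function.iterate_succ_apply]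

end Empirical

/-! ### Joinings and optimal cost -/

section Joinings

variable {X : Type*}

theorem iterate_prodMap (T : X → X) (j : ℕ) (p : X × X) :
    (Prod.map T T)^[j] p = (T^[j] p.1, T^[j] p.2) := by
  induction j with
  | zero => rfl
  | succ j ih => simp only [Function.iterate_succ_apply', ih, Prod.map]

theorem birkhoffAverage_comp_fst (T : X → X) (f : X → ℝ) (n : ℕ) (p : X × X) :
    birkhoffAverage ℝ (Prod.map T T) (fun q => f q.1) n p = birkhoffAverage ℝ T f n p.1 := by
  simp [birkhoffAverage, birkhoffSum, iterate_prodMap]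

theorem birkhoffAverage_comp_snd (T : X → X) (f : X → ℝ) (n : ℕ) (p : X × X) :
    birkhoffAverage ℝ (Prod.map T T) (fun q => f q.2) n p = birkhoffAverage ℝ T f n p.2 := by
  simp [birkhoffAverage, birkhoffSum, iterate_prodMap]

variable [MetricSpace X]

theorem orbitAvgDist_eq_birkhoffAverage (T : X → X) (n : ℕ) (x y : X) :
    orbitAvgDist T n x y =
      birkhoffAverage ℝ (Prod.map T T) (fun q => dist q.1 q.2) n (x, y) := by
  simp [orbitAvgDist, birkhoffAverage, birkhoffSum, iterate_prodMap]

theorem orbitAvgDist_comm (T : X → X) (n : ℕ) (x y : X) :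
    orbitAvgDist T n x y = orbitAvgDist T n y x := by
  simp only [orbitAvgDist, dist_comm]

theorem orbitAvgDist_nonneg (T : X → X) (n : ℕ) (x y : X) : 0 ≤ orbitAvgDist T n x y :=
  mul_nonneg (by positivity) (Finset.sum_nonneg fun _ _ => dist_nonneg)

/-- The distance as a continuous function on the product. -/
def distMap (X : Type*) [MetricSpace X] : C(X × X, ℝ) :=
  ⟨fun q => dist q.1 q.2, continuous_fst.dist continuous_snd⟩

variable [MeasurableSpace X]

omit [MetricSpace X] in
theorem isProbabilityMeasure_of_mem_joinings {T : X → X} {μ ν : Measure X}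
    [hμ : IsProbabilityMeasure μ] {l : Measure (X × X)} (hl : l ∈ joinings T μ ν) :
    IsProbabilityMeasure l := by
  constructor
  have h := hμ.measure_univ
  rwa [← hl.2.1, Measure.map_apply measurable_fst MeasurableSet.univ, Set.preimage_univ] at h

theorem rhoBar_le {T : X → X} {μ ν : Measure X} {l : Measure (X × X)} (hl : l ∈ joinings T μ ν) :
    rhoBar T μ ν ≤ ∫ p, dist p.1 p.2 ∂l :=
  csInf_le ⟨0, by rintro _ ⟨l, -, rfl⟩; exact integral_nonneg fun _ => dist_nonneg⟩ ⟨l, hl, rfl⟩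

theorem rhoBar_nonneg (T : X → X) (μ ν : Measure X) : 0 ≤ rhoBar T μ ν :=
  Real.sInf_nonneg (by rintro _ ⟨l, -, rfl⟩; exact integral_nonneg fun _ => dist_nonneg)

variable [CompactSpace X] [BorelSpace X]

/-- Empirical measures of a pair of points converge, along an ultrafilter along which the two
points are quasi-generic, to a joining. -/
theorem exists_mem_joinings_tendsto {T : X → X} (hT : Continuous T) (U : Ultrafilter ℕ)
    {n : ℕ → ℕ} (hn : Tendsto n U atTop) {μ ν : Measure X} [IsProbabilityMeasure μ]
    [IsProbabilityMeasure ν] {x y : X}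
    (hx : ∀ f : C(X, ℝ), Tendsto (fun k => birkhoffAverage ℝ T f (n k) x) U (𝓝 (∫ z, f z ∂μ)))
    (hy : ∀ f : C(X, ℝ), Tendsto (fun k => birkhoffAverage ℝ T f (n k) y) U (𝓝 (∫ z, f z ∂ν))) :
    ∃ l ∈ joinings T μ ν,
      Tendsto (fun k => orbitAvgDist T (n k) x y) U (𝓝 (∫ p, dist p.1 p.2 ∂l)) := by
  obtain ⟨l, hl, hlim⟩ := exists_tendsto_birkhoffAverage (hT.prodMap hT) U hn (x, y)
  have h1 : IsProbabilityMeasure ((l : Measure (X × X)).map Prod.fst) :=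
    Measure.isProbabilityMeasure_map measurable_fst.aemeasurable
  have h2 : IsProbabilityMeasure ((l : Measure (X × X)).map Prod.snd) :=
    Measure.isProbabilityMeasure_map measurable_snd.aemeasurable
  refine ⟨l, ⟨hl, ?_, ?_⟩, ?_⟩
  · refine ext_of_forall_integral_eq_of_IsFiniteMeasure fun f => ?_
    rw [integral_map measurable_fst.aemeasurable f.continuous.aestronglyMeasurable]
    refine tendsto_nhds_unique (hlim ⟨fun q => f q.1, f.continuous.comp continuous_fst⟩)
      ((hx f.toContinuousMap).congr fun k => ?_)
    exact (birkhoffAverage_comp_fst T f (n k) (x, y)).symm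
  · refine ext_of_forall_integral_eq_of_IsFiniteMeasure fun f => ?_
    rw [integral_map measurable_snd.aemeasurable f.continuous.aestronglyMeasurable]
    refine tendsto_nhds_unique (hlim ⟨fun q => f q.2, f.continuous.comp continuous_snd⟩)
      ((hy f.toContinuousMap).congr fun k => ?_)
    exact (birkhoffAverage_comp_snd T f (n k) (x, y)).symm
  · exact (hlim (distMap X)).congr fun k => (orbitAvgDist_eq_birkhoffAverage T (n k) x y).symm

/-- The infimum defining `rhoBar` is attained. -/
theorem exists_mem_joinings_integral_eq_rhoBar {T : X → X} (hT : Continuous T)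
    (μ ν : ProbabilityMeasure X) (hμ : MeasurePreserving T (μ : Measure X) (μ : Measure X))
    (hν : MeasurePreserving T (ν : Measure X) (ν : Measure X)) :
    ∃ l ∈ joinings T (μ : Measure X) (ν : Measure X),
      ∫ p, dist p.1 p.2 ∂l = rhoBar T (μ : Measure X) (ν : Measure X) := by
  have hTT : Continuous (Prod.map T T) := hT.prodMap hT
  -- The joinings form a closed subset of a compact space, and the cost is weakly continuous.
  let J : Set (ProbabilityMeasure (X × X)) :=
    {l | l.map hTT.measurable.aemeasurable = l} ∩
      ({l | l.map measurable_fst.aemeasurable = μ} ∩ {l | l.map measurable_snd.aemeasurable = ν})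
  have hJ : ∀ l : ProbabilityMeasure (X × X),
      (l : Measure (X × X)) ∈ joinings T (μ : Measure X) (ν : Measure X) ↔ l ∈ J := by
    intro l
    simp only [joinings, J, Set.mem_ofPred_eq, Set.mem_inter_iff,
      ← ProbabilityMeasure.toMeasure_injective.eq_iff, ProbabilityMeasure.toMeasure_map]
    exact and_congr_left fun _ => ⟨fun h => h.map_eq, fun h => ⟨hTT.measurable, h⟩⟩
  have hcl : IsClosed J :=
    (isClosed_eq (ProbabilityMeasure.continuous_map hTT) continuous_id).inter
      ((isClosed_eq (ProbabilityMeasure.continuous_map continuous_fst) continuous_const).inter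
        (isClosed_eq (ProbabilityMeasure.continuous_map continuous_snd) continuous_const))
  have hne : J.Nonempty := by
    refine ⟨⟨(μ : Measure X).prod (ν : Measure X), inferInstance⟩, (hJ _).1 ⟨hμ.prod hν, ?_, ?_⟩⟩
    · simp
    · simp
  obtain ⟨l, hl, hmin⟩ := hcl.isCompact.exists_isMinOn hne
    (ProbabilityMeasure.continuous_integral_continuousMap (distMap X)).continuousOn
  refine ⟨l, (hJ l).2 hl, le_antisymm ?_ (rhoBar_le ((hJ l).2 hl))⟩
  refine le_csInf ⟨_, _, (hJ l).2 hl, rfl⟩ ?_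
  rintro _ ⟨l', hl', rfl⟩
  have := isProbabilityMeasure_of_mem_joinings hl'
  exact hmin ((hJ ⟨l', this⟩).1 hl')

-- A Lipschitz bound up to `ε`, so that averages of distances control averages of any continuous
-- function. Close points fall under uniform continuity; at distance at least `δ` the slope `2 * |M|
-- / δ` absorbs the full oscillation.
omit [MeasurableSpace X] [BorelSpace X] in
theorem exists_abs_sub_le_add_mul_dist (f : C(X, ℝ)) {ε : ℝ} (hε : 0 < ε) :
    ∃ C, 0 ≤ C ∧ ∀ x y, |f x - f y| ≤ ε + C * dist x y := by
  obtain ⟨M, hM⟩ := exists_forall_abs_le f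
  obtain ⟨δ, hδ, h⟩ := Metric.uniformContinuous_iff.1
    (CompactSpace.uniformContinuous_of_continuous f.continuous) ε hε
  refine ⟨2 * |M| / δ, by positivity, fun x y => ?_⟩
  rcases lt_or_ge (dist x y) δ with hxy | hxy
  · have := (h hxy).le
    rw [Real.dist_eq] at this
    have : 0 ≤ 2 * |M| / δ * dist x y := by positivity
    linarith
  · have h1 : |f x - f y| ≤ 2 * |M| := by
      have := abs_sub (f x) (f y)
      have := hM x
      have := hM y
      have := le_abs_self M
      linarith
    have h2 : 2 * |M| ≤ 2 * |M| / δ * dist x y := by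
      rw [div_mul_eq_mul_div, le_div_iff₀ hδ]
      gcongr
    linarith

end Joinings

/-! ### Generic points through real test functions -/

section Generic

variable {X : Type*} [MetricSpace X] [CompactSpace X] [MeasurableSpace X] [BorelSpace X]

theorem isQuasiGeneric_iff {T : X → X} {μ : Measure X} [IsProbabilityMeasure μ] {n : ℕ → ℕ}
    {x : X} : IsQuasiGeneric T μ n x ↔ ∀ f : C(X, ℝ),
      Tendsto (fun k => birkhoffAverage ℝ T f (n k) x) atTop (𝓝 (∫ z, f z ∂μ)) := by
  constructor
  · intro h f
    have h1 := h ⟨fun z => (f z : ℂ), Complex.continuous_ofReal.comp f.continuous⟩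
    simp only [ContinuousMap.coe_mk, integral_complex_ofReal] at h1
    have h2 := (Complex.continuous_re.tendsto _).comp h1
    rw [Complex.ofReal_re] at h2
    refine h2.congr fun k => ?_
    simp only [Function.comp, birkhoffAverage, birkhoffSum, smul_eq_mul, one_div]
    rw [← Complex.ofReal_sum, ← Complex.ofReal_natCast, ← Complex.ofReal_inv,
      ← Complex.ofReal_mul, Complex.ofReal_re]
  · intro h f
    have hre := h ⟨fun z => (f z).re, Complex.continuous_re.comp f.continuous⟩
    have him := h ⟨fun z => (f z).im, Complex.continuous_im.comp f.continuous⟩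
    have h1 := ((Complex.continuous_ofReal.tendsto _).comp hre).add
      (((Complex.continuous_ofReal.tendsto _).comp him).mul_const Complex.I)
    have hi : Integrable (fun z => f z) μ :=
      Integrable.of_bound f.continuous.aestronglyMeasurable ‖f‖ (.of_forall f.norm_coe_le_norm)
    have h2 := integral_re_add_im hi
    simp only [ContinuousMap.coe_mk] at h1
    simp only [RCLike.re_to_complex, RCLike.im_to_complex, RCLike.I_to_complex,
      Complex.coe_algebraMap] at h2
    rw [h2] at h1
    refine h1.congr fun k => ?_
    simp only [Function.comp, birkhoffAverage, birkhoffSum, smul_eq_mul, one_div]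
    push_cast
    rw [mul_assoc, ← mul_add, Finset.sum_mul, ← Finset.sum_add_distrib]
    simp only [Complex.re_add_im]

theorem mem_genericPoints_iff {T : X → X} {μ : Measure X} [IsProbabilityMeasure μ] {x : X} :
    x ∈ genericPoints T μ ↔ ∀ f : C(X, ℝ),
      Tendsto (fun n => birkhoffAverage ℝ T f n x) atTop (𝓝 (∫ z, f z ∂μ)) := by
  constructor
  · intro h f
    -- The shifted sequence `k + 1` meets the positivity requirement on times.
    exact (tendsto_add_atTop_iff_nat 1).1
      (isQuasiGeneric_iff.1 (h (· + 1) (fun a b hab => Nat.succ_lt_succ hab) fun k => k.succ_pos) f)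
  · intro h n hn _
    exact isQuasiGeneric_iff.2 fun f => (h f).comp hn.tendsto_atTop

end Generic

end RhoBar

namespace RhoBar

/-! ### Averaged distance controls Birkhoff averages -/

section Besicovitch

variable {X : Type*} [MetricSpace X] [CompactSpace X]

theorem exists_forall_orbitAvgDist_le (T : X → X) : ∃ M, ∀ n x y, orbitAvgDist T n x y ≤ M := by
  obtain ⟨M, hM⟩ := exists_forall_abs_le (distMap X)
  refine ⟨M, fun n x y => ?_⟩
  rw [orbitAvgDist_eq_birkhoffAverage]
  exact (abs_le.1 (abs_birkhoffAverage_le (Prod.map T T) hM n (x, y))).2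

theorem isBoundedUnder_orbitAvgDist (T : X → X) (n : ℕ → ℕ) (x y : X) :
    atTop.IsBoundedUnder (· ≤ ·) fun k => orbitAvgDist T (n k) x y :=
  (exists_forall_orbitAvgDist_le T).elim fun M hM => isBoundedUnder_of ⟨M, fun _ => hM _ _ _⟩

theorem eventually_orbitAvgDist_lt_of_besicovitchDistAlong_lt {T : X → X} {n : ℕ → ℕ} {x y : X}
    {a : ℝ} (h : besicovitchDistAlong T n x y < a) :
    ∀ᶠ k in atTop, orbitAvgDist T (n k) x y < a :=
  eventually_lt_of_limsup_lt h (isBoundedUnder_orbitAvgDist T n x y)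

theorem eventually_orbitAvgDist_lt_of_besicovitchDist_lt {T : X → X} {x y : X}
    {a : ℝ} (h : besicovitchDist T x y < a) :
    ∀ᶠ N in atTop, orbitAvgDist T N x y < a :=
  eventually_orbitAvgDist_lt_of_besicovitchDistAlong_lt (n := id) h

omit [CompactSpace X] in
theorem besicovitchDistAlong_succ (T : X → X) (x y : X) :
    besicovitchDistAlong T (· + 1) x y = besicovitchDist T x y :=
  limsup_nat_add (fun N => orbitAvgDist T N x y) 1

omit [CompactSpace X] in
theorem abs_birkhoffAverage_sub_le {T : X → X} {f : X → ℝ} {ε C : ℝ} (hε : 0 ≤ ε)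
    (hf : ∀ x y, |f x - f y| ≤ ε + C * dist x y) (n : ℕ) (x y : X) :
    |birkhoffAverage ℝ T f n x - birkhoffAverage ℝ T f n y| ≤ ε + C * orbitAvgDist T n x y := by
  rcases Nat.eq_zero_or_pos n with rfl | hn
  · simpa [orbitAvgDist] using hε
  have hn' : (0 : ℝ) < n := by exact_mod_cast hn
  simp only [birkhoffAverage, birkhoffSum, orbitAvgDist, smul_eq_mul, one_div]
  rw [← mul_sub, ← Finset.sum_sub_distrib, abs_mul, abs_of_pos (inv_pos.2 hn'),
    inv_mul_le_iff₀ hn']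
  refine (Finset.abs_sum_le_sum_abs _ _).trans ((Finset.sum_le_sum fun j _ => hf _ _).trans_eq ?_)
  rw [Finset.sum_add_distrib, ← Finset.mul_sum]
  simp only [Finset.sum_const, Finset.card_range, nsmul_eq_mul]
  field_simp

theorem tendsto_birkhoffAverage_of_forall_eventually {T : X → X} {n : ℕ → ℕ} {y : X} {ys : ℕ → X}
    {f : C(X, ℝ)} {a : ℕ → ℝ} {b : ℝ}
    (hys : ∀ m, Tendsto (fun k => birkhoffAverage ℝ T f (n k) (ys m)) atTop (𝓝 (a m)))
    (hab : Tendsto a atTop (𝓝 b))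
    (hy : ∀ ε > 0, ∀ᶠ m in atTop, ∀ᶠ k in atTop, orbitAvgDist T (n k) y (ys m) < ε) :
    Tendsto (fun k => birkhoffAverage ℝ T f (n k) y) atTop (𝓝 b) := by
  refine Metric.tendsto_atTop'.2 fun ε hε => ?_
  have hε4 : 0 < ε / 4 := by positivity
  obtain ⟨C, hC, hf⟩ := exists_abs_sub_le_add_mul_dist f hε4
  -- Dividing by `C + 1` covers the case `C = 0`.
  have hC1 : 0 < C + 1 := by positivity
  obtain ⟨m, h1, h2⟩ := ((hy (ε / 4 / (C + 1)) (by positivity)).and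
    (hab.eventually (Metric.ball_mem_nhds b hε4))).exists
  obtain ⟨K, hK⟩ := eventually_atTop.1
    (h1.and ((hys m).eventually (Metric.ball_mem_nhds (a m) hε4)))
  refine ⟨K, fun k hk => ?_⟩
  obtain ⟨h3, h4⟩ := hK k hk.le
  have h5 := abs_birkhoffAverage_sub_le (T := T) hε4.le hf (n k) y (ys m)
  have h6 : C * orbitAvgDist T (n k) y (ys m) ≤ ε / 4 := by
    have h0 := orbitAvgDist_nonneg T (n k) y (ys m)
    rw [lt_div_iff₀ hC1] at h3
    nlinarith
  simp only [Real.dist_eq] at h2 h4 ⊢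
  rw [abs_lt] at h2 h4 ⊢
  rw [abs_le] at h5
  constructor <;> linarith

end Besicovitch

/-! ### Comparing integrals through a joining -/

section Integrals

theorem integral_comp_of_map_eq {Y Z : Type*} [MeasurableSpace Y] [MeasurableSpace Z]
    {l : Measure Y} {μ : Measure Z} {π : Y → Z} (hπ : Measurable π) (h : l.map π = μ) {F : Z → ℝ}
    (hF : Measurable F) : ∫ p, F (π p) ∂l = ∫ x, F x ∂μ := by
  rw [← h, integral_map hπ.aemeasurable hF.aestronglyMeasurable]

theorem integral_birkhoffAverage {Y : Type*} [MeasurableSpace Y] {S : Y → Y} {l : Measure Y}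
    (hS : MeasurePreserving S l l) {g : Y → ℝ} (hg : Measurable g) (hgi : Integrable g l) {n : ℕ}
    (hn : 0 < n) : ∫ y, birkhoffAverage ℝ S g n y ∂l = ∫ y, g y ∂l := by
  have hn' : (n : ℝ) ≠ 0 := by exact_mod_cast hn.ne'
  simp only [birkhoffAverage, birkhoffSum, smul_eq_mul]
  have hi : ∀ j ∈ Finset.range n, Integrable (fun y => g (S^[j] y)) l := fun j _ =>
    (hS.iterate j).integrable_comp_of_integrable hgi
  rw [integral_const_mul, integral_finsetSum _ hi]
  have : ∀ j ∈ Finset.range n, ∫ y, g (S^[j] y) ∂l = ∫ y, g y ∂l := fun j _ =>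
    integral_comp_of_map_eq (hS.iterate j).measurable (hS.iterate j).map_eq hg
  rw [Finset.sum_congr rfl this]
  simp [hn']

variable {X : Type*} [MetricSpace X] [CompactSpace X] [MeasurableSpace X] [BorelSpace X]

theorem integrable_continuousMap {l : Measure X} [IsFiniteMeasure l] (f : C(X, ℝ)) :
    Integrable f l :=
  (exists_forall_abs_le f).elim fun _ hM => integrable_of_abs_le f.continuous.measurable hM

theorem integrable_dist {l : Measure (X × X)} [IsFiniteMeasure l] :
    Integrable (fun p : X × X => dist p.1 p.2) l :=
  integrable_continuousMap (distMap X)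

/-- Invariance of the joining makes the mean of the averaged distance equal to the cost, so the
bound is uniform in `n`. This uniformity is what carries ergodicity to the limit. -/
theorem integral_abs_birkhoffAverage_sub_le {T : X → X} {μ ν : Measure X} [IsProbabilityMeasure μ]
    {l : Measure (X × X)} (hl : l ∈ joinings T μ ν) (hT : Continuous T) {f : C(X, ℝ)} {ε C : ℝ}
    (hε : 0 ≤ ε) (hf : ∀ x y, |f x - f y| ≤ ε + C * dist x y) {n : ℕ} (hn : 0 < n) :
    ∫ p, |birkhoffAverage ℝ T f n p.1 - birkhoffAverage ℝ T f n p.2| ∂l ≤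
      ε + C * ∫ p, dist p.1 p.2 ∂l := by
  have := isProbabilityMeasure_of_mem_joinings hl
  obtain ⟨M, hM⟩ := exists_forall_abs_le f
  obtain ⟨D, hD⟩ := exists_forall_abs_le (distMap X)
  have hA := measurable_birkhoffAverage hT.measurable f.continuous.measurable n
  have hdm : Measurable fun p : X × X => dist p.1 p.2 := (distMap X).continuous.measurable
  have hB := measurable_birkhoffAverage (hT.prodMap hT).measurable hdm n
  have hBi : Integrable (birkhoffAverage ℝ (Prod.map T T) (fun p : X × X => dist p.1 p.2) n) l :=
    integrable_of_abs_le hB (abs_birkhoffAverage_le _ hD n)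
  have h1 : ∫ p, (ε + C * birkhoffAverage ℝ (Prod.map T T)
      (fun p : X × X => dist p.1 p.2) n p) ∂l = ε + C * ∫ p, dist p.1 p.2 ∂l := by
    rw [integral_add (integrable_const ε) (hBi.const_mul C), integral_const_mul,
      integral_birkhoffAverage hl.1 hdm integrable_dist hn]
    simp
  rw [← h1]
  refine integral_mono (Integrable.abs (.sub
    (integrable_of_abs_le (hA.comp measurable_fst) fun p => abs_birkhoffAverage_le T hM n p.1)
    (integrable_of_abs_le (hA.comp measurable_snd) fun p => abs_birkhoffAverage_le T hM n p.2)))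
    ((integrable_const ε).add (hBi.const_mul C)) fun p => ?_
  have := abs_birkhoffAverage_sub_le (T := T) hε hf n p.1 p.2
  rwa [orbitAvgDist_eq_birkhoffAverage] at this

theorem abs_integral_sub_integral_le {T : X → X} {μ ν : Measure X} [IsProbabilityMeasure μ]
    {l : Measure (X × X)} (hl : l ∈ joinings T μ ν) {f : C(X, ℝ)} {ε C : ℝ}
    (hf : ∀ x y, |f x - f y| ≤ ε + C * dist x y) :
    |∫ x, f x ∂μ - ∫ x, f x ∂ν| ≤ ε + C * ∫ p, dist p.1 p.2 ∂l := by
  have := isProbabilityMeasure_of_mem_joinings hl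
  rw [← integral_comp_of_map_eq measurable_fst hl.2.1 f.continuous.measurable,
    ← integral_comp_of_map_eq measurable_snd hl.2.2 f.continuous.measurable]
  have h1 : Integrable (fun p : X × X => f p.1) l :=
    integrable_continuousMap ⟨fun p : X × X => f p.1, f.continuous.comp continuous_fst⟩
  have h2 : Integrable (fun p : X × X => f p.2) l :=
    integrable_continuousMap ⟨fun p : X × X => f p.2, f.continuous.comp continuous_snd⟩
  rw [← integral_sub h1 h2]
  have h3 : ∫ p, (ε + C * dist p.1 p.2) ∂l = ε + C * ∫ p, dist p.1 p.2 ∂l := by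
    rw [integral_add (integrable_const ε) (integrable_dist.const_mul C), integral_const_mul]
    simp
  rw [← h3]
  exact abs_integral_le_integral_abs.trans (integral_mono (h1.sub h2).abs
    ((integrable_const ε).add (integrable_dist.const_mul C)) fun p => hf p.1 p.2)

theorem tendsto_integral_of_tendsto_rhoBar {T : X → X} (hT : Continuous T)
    {μ : ℕ → ProbabilityMeasure X} {ν : ProbabilityMeasure X}
    (hμ : ∀ m, MeasurePreserving T (μ m : Measure X) (μ m : Measure X))
    (hν : MeasurePreserving T (ν : Measure X) (ν : Measure X))
    (h : Tendsto (fun m => rhoBar T (μ m : Measure X) (ν : Measure X)) atTop (𝓝 0))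
    (f : C(X, ℝ)) :
    Tendsto (fun m => ∫ x, f x ∂(μ m : Measure X)) atTop (𝓝 (∫ x, f x ∂(ν : Measure X))) := by
  refine Metric.tendsto_nhds.2 fun ε hε => ?_
  obtain ⟨C, hC, hf⟩ := exists_abs_sub_le_add_mul_dist f (half_pos hε)
  have h' := h.const_mul C
  rw [mul_zero] at h'
  filter_upwards [h'.eventually_lt_const (half_pos hε)] with m hm
  obtain ⟨l, hl, hlr⟩ := exists_mem_joinings_integral_eq_rhoBar hT (μ m) ν (hμ m) hν
  have := abs_integral_sub_integral_le hl hf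
  rw [hlr] at this
  rw [Real.dist_eq]
  linarith

end Integrals

/-! ### Ergodicity of the limit measure -/

section Ergodic

variable {X : Type*} [MetricSpace X] [CompactSpace X] [MeasurableSpace X] [BorelSpace X]

theorem tendsto_integral_abs_birkhoffAverage_sub {T : X → X} {μ : Measure X}
    [IsProbabilityMeasure μ] (hμ : Ergodic T μ) (f : C(X, ℝ)) :
    Tendsto (fun n => ∫ x, |birkhoffAverage ℝ T f n x - ∫ z, f z ∂μ| ∂μ) atTop (𝓝 0) := by
  obtain ⟨M, hM⟩ := exists_forall_abs_le f
  have h := tendsto_integral_of_dominated_convergence (μ := μ)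
    (F := fun n x => |birkhoffAverage ℝ T f n x - ∫ z, f z ∂μ|) (f := fun _ => 0)
    (fun _ => M + |∫ z, f z ∂μ|)
    (fun n => ((measurable_birkhoffAverage hμ.measurable
      f.continuous.measurable n).sub_const _).abs.aestronglyMeasurable)
    (integrable_const _)
    (fun n => .of_forall fun x => by
      rw [Real.norm_eq_abs, abs_abs]
      exact (abs_sub _ _).trans (by gcongr; exact abs_birkhoffAverage_le T hM n x)) ?_
  · simpa using h
  · filter_upwards [ae_tendsto_birkhoffAverage_of_ergodic hμ f.continuous.measurable hM] with x hx
    have := (hx.sub_const (∫ z, f z ∂μ)).abs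
    rwa [sub_self, abs_zero] at this

/-- An invariant measure is ergodic if the averages of continuous functions converge to their
integrals in mean. -/
theorem ergodic_of_tendsto_integral_abs_birkhoffAverage_sub {T : X → X} {ν : Measure X}
    [IsProbabilityMeasure ν] (hν : MeasurePreserving T ν ν)
    (h : ∀ f : C(X, ℝ),
      Tendsto (fun n => ∫ x, |birkhoffAverage ℝ T f n x - ∫ z, f z ∂ν| ∂ν) atTop (𝓝 0)) :
    Ergodic T ν := by
  refine ⟨hν, ⟨fun {s} hs hTs => ?_⟩⟩
  let g : X → ℝ := s.indicator fun _ => 1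
  have hg : Measurable g := measurable_const.indicator hs
  have hg1 : ∀ x, |g x| ≤ 1 := fun x => by
    by_cases hx : x ∈ s <;> simp [g, hx]
  have hgi : Integrable g ν := integrable_of_abs_le hg hg1
  have hgT : g ∘ T = g := by
    conv_rhs => rw [show g = (T ⁻¹' s).indicator fun _ => 1 by rw [hTs]]
    rfl
  have hsub : ∀ c : ℝ, Integrable (fun x => |g x - c|) ν := fun c =>
    (hgi.sub (integrable_const c)).abs
  -- Approximate the invariant indicator `g` in L¹ by a continuous `f`. Averaging fixes `g` and does
  -- not increase the L¹ distance, while the averages of `f` approach a constant; so `g` is almost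
  -- everywhere constant.
  have key : ∫ x, |g x - ∫ z, g z ∂ν| ∂ν = 0 := by
    refine le_antisymm (le_of_forall_pos_le_add fun ε hε => ?_)
      (integral_nonneg fun _ => abs_nonneg _)
    have hε4 : 0 < ε / 4 := by positivity
    obtain ⟨f', hf', -⟩ := hgi.exists_boundedContinuous_integral_sub_le hε4
    let f : C(X, ℝ) := f'.toContinuousMap
    have hf : ∫ x, |g x - f x| ∂ν ≤ ε / 4 := hf'
    obtain ⟨M, hM⟩ := exists_forall_abs_le f
    obtain ⟨n, hn, hn0⟩ := (((h f).eventually_lt_const hε4).and (eventually_gt_atTop 0)).exists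
    set c := ∫ z, f z ∂ν
    have hfi : Integrable f ν := integrable_continuousMap f
    have hAm := measurable_birkhoffAverage hν.measurable f.continuous.measurable n
    have hAi : Integrable (birkhoffAverage ℝ T f n) ν :=
      integrable_of_abs_le hAm (abs_birkhoffAverage_le T hM n)
    have h1 : ∫ x, |g x - birkhoffAverage ℝ T f n x| ∂ν ≤ ε / 4 := by
      refine le_trans ?_ hf
      have hgf : Integrable (fun x => |g x - f x|) ν := (hgi.sub hfi).abs
      have hgfm : Measurable fun x => |g x - f x| := (hg.sub f.continuous.measurable).abs
      rw [← integral_birkhoffAverage hν hgfm hgf hn0]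
      have hBi : Integrable (birkhoffAverage ℝ T (fun x => |g x - f x|) n) ν :=
        integrable_of_abs_le (measurable_birkhoffAverage hν.measurable hgfm n)
          (abs_birkhoffAverage_le T (M := 1 + M) (fun x => by
            rw [abs_abs]
            exact (abs_sub _ _).trans (add_le_add (hg1 x) (hM x))) n)
      refine integral_mono (hgi.sub hAi).abs hBi fun x => ?_
      have h2 : g x = birkhoffAverage ℝ T g n x := by
        rw [birkhoffAverage_of_comp_eq ℝ hgT (by exact_mod_cast hn0.ne')]
      have hn' : (0 : ℝ) < n := by exact_mod_cast hn0
      simp only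
      rw [h2]
      simp only [birkhoffAverage, birkhoffSum, smul_eq_mul]
      rw [← mul_sub, ← Finset.sum_sub_distrib, abs_mul, abs_of_pos (inv_pos.2 hn')]
      gcongr
      exact Finset.abs_sum_le_sum_abs _ _
    have hi1 : Integrable (fun x => |g x - birkhoffAverage ℝ T f n x|) ν := (hgi.sub hAi).abs
    have hi2 : Integrable (fun x => |birkhoffAverage ℝ T f n x - c|) ν :=
      (hAi.sub (integrable_const c)).abs
    have h2 : ∫ x, |g x - c| ∂ν ≤ ε / 2 := by
      have h3 : ∫ x, |g x - c| ∂ν ≤ ∫ x, (|g x - birkhoffAverage ℝ T f n x| +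
          |birkhoffAverage ℝ T f n x - c|) ∂ν :=
        integral_mono (hsub c) (hi1.add hi2)
          fun x => abs_sub_le _ _ _
      rw [integral_add hi1 hi2] at h3
      linarith
    have h3 : |c - ∫ z, g z ∂ν| ≤ ε / 2 := by
      rw [abs_sub_comm]
      have : ∫ z, g z ∂ν - c = ∫ z, (g z - c) ∂ν := by
        rw [integral_sub hgi (integrable_const c)]; simp
      rw [this]
      exact abs_integral_le_integral_abs.trans h2
    have h4 : ∫ x, |g x - ∫ z, g z ∂ν| ∂ν ≤ ∫ x, (|g x - c| + |c - ∫ z, g z ∂ν|) ∂ν :=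
      integral_mono (hsub _) ((hsub c).add (integrable_const _)) fun x => abs_sub_le _ _ _
    rw [integral_add (hsub c) (integrable_const _), integral_const, probReal_univ, one_smul] at h4
    linarith
  have hae := (integral_eq_zero_iff_of_nonneg (fun _ => abs_nonneg _) (hsub _)).1 key
  rw [eventuallyConst_set']
  by_cases h0 : ∫ z, g z ∂ν = 0
  · left
    filter_upwards [hae] with x hx
    have hx' : g x = 0 := by simpa [h0] using hx
    have : x ∉ s := fun hxs => by simp [g, hxs] at hx'
    exact eq_false this
  · right
    filter_upwards [hae] with x hx
    have hx' : g x = ∫ z, g z ∂ν := sub_eq_zero.1 (abs_eq_zero.1 hx)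
    have : x ∈ s := by
      by_contra hxs
      exact h0 (by rw [← hx']; simp [g, hxs])
    exact eq_true this

/-- Fix `m` with small cost, then let `n` grow. Across an optimal joining, the averages for `ν`
differ little in mean from those for `μ m`, which tend to an integral close to that of `ν`. -/
theorem ergodic_of_tendsto_rhoBar {T : X → X} (hT : Continuous T)
    {μ : ℕ → ProbabilityMeasure X} {ν : ProbabilityMeasure X}
    (hμ : ∀ m, Ergodic T (μ m : Measure X))
    (hν : MeasurePreserving T (ν : Measure X) (ν : Measure X))
    (h : Tendsto (fun m => rhoBar T (μ m : Measure X) (ν : Measure X)) atTop (𝓝 0)) :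
    Ergodic T (ν : Measure X) := by
  refine ergodic_of_tendsto_integral_abs_birkhoffAverage_sub hν fun f => ?_
  refine tendsto_order.2 ⟨fun a ha => .of_forall fun n =>
    ha.trans_le (integral_nonneg fun _ => abs_nonneg _), fun ε hε => ?_⟩
  have hε4 : 0 < ε / 4 := by positivity
  obtain ⟨C, hC, hf⟩ := exists_abs_sub_le_add_mul_dist f hε4
  obtain ⟨M, hM⟩ := exists_forall_abs_le f
  have h' := h.const_mul C
  rw [mul_zero] at h'
  have hint := tendsto_integral_of_tendsto_rhoBar hT (fun m => (hμ m).toMeasurePreserving) hν h f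
  obtain ⟨m, hm, hm'⟩ := ((h'.eventually_lt_const hε4).and
    (hint.eventually (Metric.ball_mem_nhds _ hε4))).exists
  simp only [Real.dist_eq] at hm'
  obtain ⟨l, hl, hlr⟩ := exists_mem_joinings_integral_eq_rhoBar hT (μ m) ν
    (hμ m).toMeasurePreserving hν
  have := isProbabilityMeasure_of_mem_joinings hl
  filter_upwards [(tendsto_integral_abs_birkhoffAverage_sub (hμ m) f).eventually_lt_const hε4,
    eventually_gt_atTop 0] with n hn hn0
  have h1 := integral_abs_birkhoffAverage_sub_le hl hT hε4.le hf hn0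
  rw [hlr] at h1
  have hA := measurable_birkhoffAverage hT.measurable f.continuous.measurable n
  set a := ∫ z, f z ∂(μ m : Measure X)
  set b := ∫ z, f z ∂(ν : Measure X)
  rw [← integral_comp_of_map_eq measurable_fst hl.2.1 (hA.sub_const a).abs] at hn
  rw [← integral_comp_of_map_eq measurable_snd hl.2.2 (hA.sub_const b).abs]
  have hA1 : Integrable (fun p : X × X => birkhoffAverage ℝ T f n p.1) l :=
    integrable_of_abs_le (hA.comp measurable_fst) fun p => abs_birkhoffAverage_le T hM n p.1
  have hA2 : Integrable (fun p : X × X => birkhoffAverage ℝ T f n p.2) l :=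
    integrable_of_abs_le (hA.comp measurable_snd) fun p => abs_birkhoffAverage_le T hM n p.2
  have hi1 : Integrable (fun p : X × X =>
      |birkhoffAverage ℝ T f n p.1 - birkhoffAverage ℝ T f n p.2|) l := (hA1.sub hA2).abs
  have hi2 : Integrable (fun p : X × X => |birkhoffAverage ℝ T f n p.1 - a|) l :=
    (hA1.sub (integrable_const a)).abs
  have h2 : ∫ p, |birkhoffAverage ℝ T f n p.2 - b| ∂l ≤
      ∫ p, (|birkhoffAverage ℝ T f n p.1 - birkhoffAverage ℝ T f n p.2| +
        |birkhoffAverage ℝ T f n p.1 - a| + |a - b|) ∂l := by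
    refine integral_mono (hA2.sub (integrable_const b)).abs
      ((hi1.add hi2).add (integrable_const _))
      fun p => ?_
    have h3 := abs_sub_le (birkhoffAverage ℝ T f n p.2) (birkhoffAverage ℝ T f n p.1) b
    have h4 := abs_sub_le (birkhoffAverage ℝ T f n p.1) a b
    have h5 := abs_sub_comm (birkhoffAverage ℝ T f n p.2) (birkhoffAverage ℝ T f n p.1)
    simp only
    linarith
  have h6 : ∫ p, (|birkhoffAverage ℝ T f n p.1 - birkhoffAverage ℝ T f n p.2| +
        |birkhoffAverage ℝ T f n p.1 - a| + |a - b|) ∂l =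
      ∫ p, |birkhoffAverage ℝ T f n p.1 - birkhoffAverage ℝ T f n p.2| ∂l +
        ∫ p, |birkhoffAverage ℝ T f n p.1 - a| ∂l + |a - b| := by
    have h7 := integral_add (hi1.add hi2) (integrable_const (μ := l) |a - b|)
    simp only [Pi.add_apply] at h7
    rw [h7, integral_add hi1 hi2]
    simp
  linarith

end Ergodic

end RhoBar

namespace RhoBar

/-! ### Generic points realising the distances, and construction of the limit measure -/

variable {X : Type*} [MetricSpace X] [CompactSpace X] [MeasurableSpace X] [BorelSpace X]

/-- Almost every point of an ergodic measure is generic. -/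
theorem ae_mem_genericPoints {T : X → X} {μ : Measure X} [IsProbabilityMeasure μ]
    (hμ : Ergodic T μ) : ∀ᵐ x ∂μ, x ∈ genericPoints T μ := by
  have h : ∀ᵐ x ∂μ, ∀ i, Tendsto (fun n => birkhoffAverage ℝ T
      (TopologicalSpace.denseSeq C(X, ℝ) i) n x) atTop
      (𝓝 (∫ z, TopologicalSpace.denseSeq C(X, ℝ) i z ∂μ)) := by
    refine ae_all_iff.2 fun i => ?_
    obtain ⟨M, hM⟩ := exists_forall_abs_le (TopologicalSpace.denseSeq C(X, ℝ) i)
    exact ae_tendsto_birkhoffAverage_of_ergodic hμ (ContinuousMap.continuous _).measurable hM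
  filter_upwards [h] with x hx
  refine mem_genericPoints_iff.2 fun f => Metric.tendsto_nhds.2 fun ε hε => ?_
  have hε3 : 0 < ε / 3 := by positivity
  obtain ⟨i, hi⟩ := (TopologicalSpace.denseRange_denseSeq C(X, ℝ)).exists_dist_lt f hε3
  set g := TopologicalSpace.denseSeq C(X, ℝ) i
  have hfg : ∀ y, |(f - g) y| ≤ ε / 3 := fun y =>
    ((f - g).norm_coe_le_norm y).trans (by rw [← dist_eq_norm]; exact hi.le)
  have h1 : |∫ z, f z ∂μ - ∫ z, g z ∂μ| ≤ ε / 3 := by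
    rw [← integral_sub (integrable_continuousMap f) (integrable_continuousMap g)]
    have := norm_integral_le_of_norm_le_const (μ := μ) (f := fun z => f z - g z)
      (.of_forall hfg)
    simpa using this
  filter_upwards [Metric.tendsto_nhds.1 (hx i) (ε / 3) hε3] with n hn
  have h2 := abs_birkhoffAverage_le T hfg n x
  have h3 : birkhoffAverage ℝ T (f - g) n x =
      birkhoffAverage ℝ T f n x - birkhoffAverage ℝ T g n x := by
    simp [birkhoffAverage, birkhoffSum, mul_sub]
  rw [h3] at h2
  rw [Real.dist_eq] at hn ⊢
  rw [abs_le] at h1 h2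
  rw [abs_lt] at hn ⊢
  constructor <;> linarith

/-- The averaged distance along generic orbits is asymptotically at least `rhoBar`. -/
theorem eventually_rhoBar_sub_lt_orbitAvgDist {T : X → X} (hT : Continuous T) {μ ν : Measure X}
    [IsProbabilityMeasure μ] [IsProbabilityMeasure ν] {x y : X} (hx : x ∈ genericPoints T μ)
    (hy : y ∈ genericPoints T ν) {ε : ℝ} (hε : 0 < ε) :
    ∀ᶠ n in atTop, rhoBar T μ ν - ε < orbitAvgDist T n x y := by
  by_contra hcon
  rw [not_eventually] at hcon
  have hne := frequently_iff_neBot.1 hcon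
  -- An ultrafilter carried by the bad times would produce a joining of cost at most `rhoBar T μ ν -
  -- ε`.
  let U := Ultrafilter.of (atTop ⊓ 𝓟 {n | ¬ rhoBar T μ ν - ε < orbitAvgDist T n x y})
  have hU := Ultrafilter.of_le (atTop ⊓ 𝓟 {n | ¬ rhoBar T μ ν - ε < orbitAvgDist T n x y})
  have hU1 : (U : Filter ℕ) ≤ atTop := hU.trans inf_le_left
  have hU2 : ∀ᶠ n in (U : Filter ℕ), orbitAvgDist T n x y ≤ rhoBar T μ ν - ε := by
    filter_upwards [(hU.trans inf_le_right) (mem_principal_self _)] with n hn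
    exact not_lt.1 hn
  obtain ⟨l, hl, hlim⟩ := exists_mem_joinings_tendsto hT U (n := id) hU1
    (fun f => (mem_genericPoints_iff.1 hx f).mono_left hU1)
    (fun f => (mem_genericPoints_iff.1 hy f).mono_left hU1)
  have h1 := le_of_tendsto hlim hU2
  have h2 := rhoBar_le hl
  linarith

/-- Almost every point of the second marginal is a second coordinate of a point of a given
conull set. -/
theorem ae_exists_of_ae {Y Z : Type*} [MeasurableSpace Y] [StandardBorelSpace Y]
    [MeasurableSpace Z] {l : Measure (Y × Z)} [IsProbabilityMeasure l] {P : Y × Z → Prop}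
    (h : ∀ᵐ p ∂l, P p) : ∀ᵐ z ∂(l.map Prod.snd), ∃ y, P (y, z) := by
  have hne : Nonempty Y := (l.nonempty_of_neZero).map Prod.fst
  have hl : IsProbabilityMeasure (l.map Prod.swap) :=
    Measure.isProbabilityMeasure_map measurable_swap.aemeasurable
  -- Conditional kernels disintegrate over the first coordinate, hence the swap. Almost every fibre
  -- measure is a probability measure, so its conull set is nonempty, and no measurability of a
  -- projection is needed.
  have h1 : ∀ᵐ q ∂(l.map Prod.swap), P q.swap := 
    (MeasurableEquiv.prodComm (α := Y) (β := Z)).measurableEmbedding.ae_map_iff.2 h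
  rw [← (l.map Prod.swap).disintegrate (l.map Prod.swap).condKernel] at h1
  have h2 := Measure.ae_ae_of_ae_compProd h1
  have h3 : (l.map Prod.swap).fst = l.map Prod.snd := by
    rw [Measure.fst, Measure.map_map measurable_fst measurable_swap]
    rfl
  rw [h3] at h2
  filter_upwards [h2] with z hz
  exact hz.exists

theorem exists_genericPoints_tendsto_orbitAvgDist {T : X → X} (hT : Continuous T)
    {μ : ℕ → ProbabilityMeasure X} {ν : ProbabilityMeasure X}
    (hμ : ∀ m, Ergodic T (μ m : Measure X)) (hν : Ergodic T (ν : Measure X)) :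
    ∃ (xs : ℕ → X) (x : X), x ∈ genericPoints T (ν : Measure X) ∧
      (∀ m, xs m ∈ genericPoints T (μ m : Measure X)) ∧
      ∀ m, Tendsto (fun N => orbitAvgDist T N x (xs m)) atTop
        (𝓝 (rhoBar T (μ m : Measure X) (ν : Measure X))) := by
  have key : ∀ m, ∀ᵐ x ∂(ν : Measure X), ∃ x', x' ∈ genericPoints T (μ m : Measure X) ∧
      Tendsto (fun N => orbitAvgDist T N x x') atTop
        (𝓝 (rhoBar T (μ m : Measure X) (ν : Measure X))) := by
    intro m
    obtain ⟨l, hl, hlr⟩ := exists_mem_joinings_integral_eq_rhoBar hT (μ m) ν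
      (hμ m).toMeasurePreserving hν.toMeasurePreserving
    have := isProbabilityMeasure_of_mem_joinings hl
    obtain ⟨D, hD⟩ := exists_forall_abs_le (distMap X)
    have h1 : ∀ᵐ p ∂l, p.1 ∈ genericPoints T (μ m : Measure X) :=
      ae_of_ae_map measurable_fst.aemeasurable (by rw [hl.2.1]; exact ae_mem_genericPoints (hμ m))
    have h2 : ∀ᵐ p ∂l, p.2 ∈ genericPoints T (ν : Measure X) :=
      ae_of_ae_map measurable_snd.aemeasurable (by rw [hl.2.2]; exact ae_mem_genericPoints hν)
    -- Optimality enters here: the lower bound from genericity coincides with the mean `hlr`.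
    have h3 := ae_tendsto_birkhoffAverage_of_le hl.1
      (distMap X).continuous.measurable hD hlr (by
        filter_upwards [h1, h2] with p hp1 hp2 ε hε
        filter_upwards [eventually_rhoBar_sub_lt_orbitAvgDist hT hp1 hp2 hε] with n hn
        rwa [orbitAvgDist_eq_birkhoffAverage] at hn)
    rw [← hl.2.2]
    refine ae_exists_of_ae (P := fun p => p.1 ∈ genericPoints T (μ m : Measure X) ∧
      Tendsto (fun N => orbitAvgDist T N p.2 p.1) atTop
        (𝓝 (rhoBar T (μ m : Measure X) (l.map Prod.snd)))) ?_
    rw [hl.2.2]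
    filter_upwards [h1, h3] with p hp1 hp3
    refine ⟨hp1, hp3.congr fun n => ?_⟩
    rw [orbitAvgDist_comm, orbitAvgDist_eq_birkhoffAverage]
    rfl
  obtain ⟨x, hx, hx'⟩ := ((ae_mem_genericPoints hν).and (ae_all_iff.2 key)).exists
  choose xs h1 h2 using hx'
  exact ⟨xs, x, hx, h1, h2⟩

theorem isQuasiGeneric_of_tendsto_rhoBar {T : X → X} (hT : Continuous T)
    {μ : ℕ → ProbabilityMeasure X} {ν : ProbabilityMeasure X}
    (hμ : ∀ m, MeasurePreserving T (μ m : Measure X) (μ m : Measure X))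
    (hν : MeasurePreserving T (ν : Measure X) (ν : Measure X))
    (h : Tendsto (fun m => rhoBar T (μ m : Measure X) (ν : Measure X)) atTop (𝓝 0))
    {n : ℕ → ℕ} {ys : ℕ → X} {y : X} (hys : ∀ m, IsQuasiGeneric T (μ m : Measure X) n (ys m))
    (hy : ∀ ε > 0, ∀ᶠ m in atTop, ∀ᶠ k in atTop, orbitAvgDist T (n k) y (ys m) < ε) :
    IsQuasiGeneric T (ν : Measure X) n y :=
  isQuasiGeneric_iff.2 fun f => tendsto_birkhoffAverage_of_forall_eventually
    (fun m => isQuasiGeneric_iff.1 (hys m) f)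
    (tendsto_integral_of_tendsto_rhoBar hT hμ hν h f) hy

/-- An ultrafilter chosen once makes `y` quasi-generic for a single `ν`; the pair limits along it
then give joinings for every `m`, so the cost is at most the Besicovitch distance. -/
theorem exists_tendsto_rhoBar {T : X → X} (hT : Continuous T) {μ : ℕ → ProbabilityMeasure X}
    {n : ℕ → ℕ} (hn : StrictMono n) {ys : ℕ → X} {y : X}
    (hys : ∀ m, IsQuasiGeneric T (μ m : Measure X) n (ys m))
    (hy : Tendsto (fun m => besicovitchDistAlong T n y (ys m)) atTop (𝓝 0)) :
    ∃ ν : ProbabilityMeasure X, MeasurePreserving T (ν : Measure X) (ν : Measure X) ∧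
      Tendsto (fun m => rhoBar T (μ m : Measure X) (ν : Measure X)) atTop (𝓝 0) := by
  let U := Ultrafilter.of (atTop : Filter ℕ)
  have hU : (U : Filter ℕ) ≤ atTop := Ultrafilter.of_le _
  have hnU : Tendsto n U atTop := hn.tendsto_atTop.mono_left hU
  obtain ⟨ν, hν, hlim⟩ := exists_tendsto_birkhoffAverage hT U hnU y
  refine ⟨ν, hν, squeeze_zero (fun m => rhoBar_nonneg _ _ _) (fun m => ?_) hy⟩
  obtain ⟨l, hl, hl'⟩ := exists_mem_joinings_tendsto hT U hnU
    (fun f => (isQuasiGeneric_iff.1 (hys m) f).mono_left hU) hlim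
  refine (rhoBar_le hl).trans (le_of_forall_gt_imp_ge_of_dense fun a ha => ?_)
  refine le_of_tendsto hl' ?_
  filter_upwards [hU (eventually_orbitAvgDist_lt_of_besicovitchDistAlong_lt ha)] with k hk
  rw [orbitAvgDist_comm]
  exact le_of_lt hk

end RhoBar

theorem mainTheorem8 {X : Type*} [MetricSpace X] [CompactSpace X] [MeasurableSpace X]
    [BorelSpace X] (T : X → X) (hT : Continuous T) (μ : ℕ → ProbabilityMeasure X)
    (hμ : ∀ m, Ergodic T (μ m : Measure X)) :
    -- the three conditions are equivalent
    List.TFAE [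
      ∃ ν : ProbabilityMeasure X, MeasurePreserving T (ν : Measure X) (ν : Measure X) ∧
        Tendsto (fun m => RhoBar.rhoBar T (μ m : Measure X) (ν : Measure X)) atTop (𝓝 0),
      ∃ (xs : ℕ → X) (x : X), (∀ m, xs m ∈ RhoBar.genericPoints T (μ m : Measure X)) ∧
        Tendsto (fun m => RhoBar.besicovitchDist T x (xs m)) atTop (𝓝 0),
      ∃ (n : ℕ → ℕ) (ys : ℕ → X) (y : X), StrictMono n ∧ (∀ k, 0 < n k) ∧
        (∀ m, RhoBar.IsQuasiGeneric T (μ m : Measure X) n (ys m)) ∧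
        Tendsto (fun m => RhoBar.besicovitchDistAlong T n y (ys m)) atTop (𝓝 0)] ∧
    -- consequences for every limit measure
    ∀ ν : ProbabilityMeasure X, MeasurePreserving T (ν : Measure X) (ν : Measure X) →
      Tendsto (fun m => RhoBar.rhoBar T (μ m : Measure X) (ν : Measure X)) atTop (𝓝 0) →
      Ergodic T (ν : Measure X) ∧
      -- every point `x` as in the second condition is generic for the limit measure
      (∀ (xs : ℕ → X) (x : X), (∀ m, xs m ∈ RhoBar.genericPoints T (μ m : Measure X)) →
        Tendsto (fun m => RhoBar.besicovitchDist T x (xs m)) atTop (𝓝 0) →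
        x ∈ RhoBar.genericPoints T (ν : Measure X)) ∧
      -- every point `y` as in the third condition is quasi-generic for the limit measure
      (∀ (n : ℕ → ℕ) (ys : ℕ → X) (y : X), StrictMono n → (∀ k, 0 < n k) →
        (∀ m, RhoBar.IsQuasiGeneric T (μ m : Measure X) n (ys m)) →
        Tendsto (fun m => RhoBar.besicovitchDistAlong T n y (ys m)) atTop (𝓝 0) →
        RhoBar.IsQuasiGeneric T (ν : Measure X) n y) ∧
      -- the points in the second condition can be chosen to realise the distances
      ∃ (xs : ℕ → X) (x : X), x ∈ RhoBar.genericPoints T (ν : Measure X) ∧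
        (∀ m, xs m ∈ RhoBar.genericPoints T (μ m : Measure X)) ∧
        Tendsto (fun m => RhoBar.besicovitchDist T x (xs m)) atTop (𝓝 0) ∧
        ∀ m, RhoBar.besicovitchDist T x (xs m) =
              RhoBar.rhoBar T (μ m : Measure X) (ν : Measure X) ∧
          Tendsto (fun N : ℕ => RhoBar.orbitAvgDist T N x (xs m)) atTop
            (𝓝 (RhoBar.rhoBar T (μ m : Measure X) (ν : Measure X))) := by
  have final : ∀ ν : ProbabilityMeasure X, Ergodic T (ν : Measure X) →
      Tendsto (fun m => RhoBar.rhoBar T (μ m : Measure X) (ν : Measure X)) atTop (𝓝 0) →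
      ∃ (xs : ℕ → X) (x : X), x ∈ RhoBar.genericPoints T (ν : Measure X) ∧
        (∀ m, xs m ∈ RhoBar.genericPoints T (μ m : Measure X)) ∧
        Tendsto (fun m => RhoBar.besicovitchDist T x (xs m)) atTop (𝓝 0) ∧
        ∀ m, RhoBar.besicovitchDist T x (xs m) =
              RhoBar.rhoBar T (μ m : Measure X) (ν : Measure X) ∧
          Tendsto (fun N : ℕ => RhoBar.orbitAvgDist T N x (xs m)) atTop
            (𝓝 (RhoBar.rhoBar T (μ m : Measure X) (ν : Measure X))) := by
    intro ν hν h
    obtain ⟨xs, x, hx, hxs, hlim⟩ := RhoBar.exists_genericPoints_tendsto_orbitAvgDist hT hμ hν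
    have heq : ∀ m, RhoBar.besicovitchDist T x (xs m) =
        RhoBar.rhoBar T (μ m : Measure X) (ν : Measure X) := fun m => (hlim m).limsup_eq
    exact ⟨xs, x, hx, hxs, h.congr fun m => (heq m).symm, fun m => ⟨heq m, hlim m⟩⟩
  have hμ' := fun m => (hμ m).toMeasurePreserving
  refine ⟨?_, fun ν hν h => ⟨RhoBar.ergodic_of_tendsto_rhoBar hT hμ hν h, ?_, ?_,
    final ν (RhoBar.ergodic_of_tendsto_rhoBar hT hμ hν h) h⟩⟩
  · tfae_have 1 → 2 := by
      rintro ⟨ν, hν, h⟩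
      obtain ⟨xs, x, -, hxs, hlim, -⟩ := final ν (RhoBar.ergodic_of_tendsto_rhoBar hT hμ hν h) h
      exact ⟨xs, x, hxs, hlim⟩
    tfae_have 2 → 3 := by
      rintro ⟨xs, x, hxs, hlim⟩
      have hmono : StrictMono fun k : ℕ => k + 1 := fun a b hab => Nat.succ_lt_succ hab
      exact ⟨fun k => k + 1, xs, x, hmono, fun k => k.succ_pos,
        fun m => hxs m _ hmono fun k => k.succ_pos,
        hlim.congr fun m => (RhoBar.besicovitchDistAlong_succ T x (xs m)).symm⟩
    tfae_have 3 → 1 := by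
      rintro ⟨n, ys, y, hn, -, hys, hy⟩
      exact RhoBar.exists_tendsto_rhoBar hT hn hys hy
    tfae_finish
  · intro xs x hxs hlim n hn hpos
    refine RhoBar.isQuasiGeneric_of_tendsto_rhoBar hT hμ' hν h (fun m => hxs m n hn hpos)
      fun ε hε => ?_
    filter_upwards [hlim.eventually_lt_const hε] with m hm
    exact hn.tendsto_atTop.eventually
      (RhoBar.eventually_orbitAvgDist_lt_of_besicovitchDist_lt hm)
  · intro n ys y hn hpos hys hlim
    refine RhoBar.isQuasiGeneric_of_tendsto_rhoBar hT hμ' hν h hys fun ε hε => ?_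
    filter_upwards [hlim.eventually_lt_const hε] with m hm
    exact RhoBar.eventually_orbitAvgDist_lt_of_besicovitchDistAlong_lt hm
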